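/- Let $k$ be a field of characteristic $0$ and let $A=\bigoplus_{n\ge 0}A_n$ be a connected graded $k$-algebra (i.e. $\mathbb N$-graded with $A_0=k$) that is a domain, not necessarily commutative, of finite Gelfand-Kirillov dimension. Assume that $A$ is a finitely generated free module over its center $Z$. For a $Z$-basis $z_1,\dots,z_r$ of $A$ let $d(A/Z)=\det(\operatorname{tr}(z_iz_j))_{i,j}\in Z$ be the discriminant, where $\operatorname{tr}(a)$ is the trace of left multiplication by $a$ on the free $Z$-module $A$; it is unique up to a unit of $Z$. For $F\subseteq A$ let $Sw(F)$ be the set of all $g\in A$ such that $f=agb$ for some $a,b\in A$ and some $0\ne f\in F$. Put $D_0=\{d(A/Z)\}$, let $D_{n}$ be the $k$-subalgebra of $A$ generated by $Sw(D_{n-1})$ for $n\ge 1$, and let $\mathbb D(A)=\bigcup_{n\ge 0}D_n$ be the discriminant-divisor subalgebra of $A$ (which does not depend on the choice of basis). If $\mathbb D(A)=A$, then: 1. $A$ is cancellative: for every $k$-algebra $B$, if $A[t]\cong B[t]$ as $k$-algebras, then $A\cong B$ as $k$-algebras; 2. $A$ is strongly cancellative: for every $d\ge 1$ and every $k$-algebra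 $B$, if $A[t_1,\dots,t_d]\cong B[t_1,\dots,t_d]$ as $k$-algebras, then $A\cong B$ as $k$-algebras; 3. $A$ has no nontrivial unipotent automorphism: if $g$ is a $k$-algebra automorphism of $A$ such that, for every $n\geq 0$ and every $v\in A_n$, $g(v)-v\in\bigoplus_{m>n}A_m$, then $g$ is the identity. Here algebras are associative and unital, and the polynomial variables are central and commute with each other. -/

import Mathlib

universe u v w

/-- The dimension of `∑_{i ≤ n} Vⁱ = (k + V)ⁿ` over `k`, where `V` is a subspace of `A`. -/
noncomputable def growthFunction (k : Type u) (A : Type v) [Field k] [Ring A] [Algebra k A]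
    (V : Submodule k A) (n : ℕ) : ℕ :=
  Module.finrank k (((1 ⊔ V) ^ n : Submodule k A))

/-- The Gelfand-Kirillov dimension: the supremum, over all finite-dimensional subspaces `V`
of `A`, of `limsup_n log (dim ∑_{i ≤ n} Vⁱ) / log n`. -/
noncomputable def gkDim (k : Type u) (A : Type v) [Field k] [Ring A] [Algebra k A] : EReal :=
  ⨆ V : {V : Submodule k A // V.FG},
    Filter.limsup
      (fun n : ℕ => ((Real.log (growthFunction k A V.1 n) / Real.log n : ℝ) : EReal))
      Filter.atTop

/-- An `ℕ`-grading is connected if its degree zero part is the base field `k · 1`. -/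
def IsConnectedGrading (k : Type u) {A : Type v} [Field k] [Ring A] [Algebra k A]
    (𝒜 : ℕ → Submodule k A) : Prop :=
  𝒜 0 = (⊥ : Subalgebra k A).toSubmodule

/-- The discriminant `det (tr (bᵢ bⱼ))` of `A` over its center `Z` with respect to a `Z`-basis `b`
of `A`; here `tr a` is the trace of left multiplication by `a` on the free `Z`-module `A`.
Another basis changes it by a unit of `Z` only. -/
noncomputable def centerDiscr {A : Type v} [Ring A] {ι : Type w} [Fintype ι] [DecidableEq ι]
    (b : Module.Basis ι (Subring.center A) A) : Subring.center A :=
  Matrix.det (Matrix.of fun i j : ι =>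
    LinearMap.trace (Subring.center A) A (LinearMap.mulLeft (Subring.center A) (b i * b j)))

/-- `Sw(F)`: the elements `g` with `f = a g b` for some `a, b` in `A` and some nonzero `f` in
`F`. -/
def subwords {A : Type v} [Ring A] (F : Set A) : Set A :=
  {g | ∃ f ∈ F, f ≠ 0 ∧ ∃ a b : A, f = a * g * b}

/-- `D₀(F) = F`, and `Dₙ₊₁(F)` is the subalgebra generated by `Sw(Dₙ(F))`. -/
def divisorStage (k : Type u) {A : Type v} [Field k] [Ring A] [Algebra k A] (F : Set A) :
    ℕ → Set A
  | 0 => F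
  | n + 1 => (Algebra.adjoin k (subwords (divisorStage k F n)) : Set A)

theorem divisorStage_subset_succ (k : Type u) {A : Type v} [Field k] [Ring A] [Algebra k A]
    (F : Set A) (n : ℕ) : divisorStage k F n ⊆ divisorStage k F (n + 1) := by
  intro x hx
  change x ∈ Algebra.adjoin k (subwords (divisorStage k F n))
  by_cases h : x = 0
  · subst h
    exact Subalgebra.zero_mem _
  · exact Algebra.subset_adjoin ⟨x, hx, h, 1, 1, by simp⟩

theorem divisorStage_mono (k : Type u) {A : Type v} [Field k] [Ring A] [Algebra k A]
    (F : Set A) : Monotone (divisorStage k F) :=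
  monotone_nat_of_le_succ (divisorStage_subset_succ k F)

/-- The `F`-divisor subalgebra `D(F) = ⋃ₙ Dₙ(F)`. -/
def divisorSubalgebra (k : Type u) {A : Type v} [Field k] [Ring A] [Algebra k A] (F : Set A) :
    Subalgebra k A where
  carrier := ⋃ n, divisorStage k F n
  mul_mem' := by
    intro x y hx hy
    obtain ⟨m, hm⟩ := Set.mem_iUnion.1 hx
    obtain ⟨n, hn⟩ := Set.mem_iUnion.1 hy
    have h1 := divisorStage_mono k F (show m ≤ max m n + 1 by omega) hm
    have h2 := divisorStage_mono k F (show n ≤ max m n + 1 by omega) hn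
    exact Set.mem_iUnion.2 ⟨max m n + 1, Subalgebra.mul_mem _ h1 h2⟩
  add_mem' := by
    intro x y hx hy
    obtain ⟨m, hm⟩ := Set.mem_iUnion.1 hx
    obtain ⟨n, hn⟩ := Set.mem_iUnion.1 hy
    have h1 := divisorStage_mono k F (show m ≤ max m n + 1 by omega) hm
    have h2 := divisorStage_mono k F (show n ≤ max m n + 1 by omega) hn
    exact Set.mem_iUnion.2 ⟨max m n + 1, Subalgebra.add_mem _ h1 h2⟩
  algebraMap_mem' := fun r => Set.mem_iUnion.2 ⟨1, Subalgebra.algebraMap_mem _ r⟩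

/-- The discriminant-divisor subalgebra `D(d(A/Z))` of `A`, where `Z` is the center of `A` and the
discriminant is computed with the `Z`-basis `b` of `A`. It does not depend on `b`, since
`D(f) = D(u f)` for every unit `u` of `Z`. -/
noncomputable def discriminantDivisorSubalgebra (k : Type u) {A : Type v} [Field k] [Ring A]
    [Algebra k A] {ι : Type w} [Fintype ι] [DecidableEq ι]
    (b : Module.Basis ι (Subring.center A) A) : Subalgebra k A :=
  divisorSubalgebra k {(centerDiscr b : A)}

/-- `A` is cancellative: `A[t] ≅ B[t]` as `k`-algebras implies `A ≅ B` (the variable `t` is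
central, `A` and `B` need not be commutative). -/
def IsCancellative (k : Type u) (A : Type v) [Field k] [Ring A] [Algebra k A] : Prop :=
  ∀ (B : Type w) [Ring B] [Algebra k B],
    Nonempty (Polynomial A ≃ₐ[k] Polynomial B) → Nonempty (A ≃ₐ[k] B)

/-- The polynomial ring `A[t₁, …, t_d]` in `d` commuting central variables over a ring `A` that
need not be commutative: the monoid algebra over `A` of the monoid `ℕ^d` of monomials. -/
abbrev CentralPolynomial (A : Type v) [Ring A] (d : ℕ) : Type v :=
  AddMonoidAlgebra A (Fin d →₀ ℕ)

/-- `A` is strongly cancellative: for every `d ≥ 1`, an isomorphism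
`A[t₁, …, t_d] ≅ B[t₁, …, t_d]` of `k`-algebras implies `A ≅ B`. -/
def IsStronglyCancellative (k : Type u) (A : Type v) [Field k] [Ring A] [Algebra k A] : Prop :=
  ∀ d : ℕ, 1 ≤ d → ∀ (B : Type w) [Ring B] [Algebra k B],
    Nonempty (CentralPolynomial A d ≃ₐ[k] CentralPolynomial B d) → Nonempty (A ≃ₐ[k] B)

/-- An algebra automorphism `g` of a graded algebra is unipotent if, for every homogeneous
element `v`, `g v = v +` (a sum of homogeneous elements of degree greater than that of `v`). -/
def IsUnipotentAut (k : Type u) {A : Type v} [Field k] [Ring A] [Algebra k A]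
    (𝒜 : ℕ → Submodule k A) (g : A ≃ₐ[k] A) : Prop :=
  ∀ n : ℕ, ∀ v ∈ 𝒜 n, g v - v ∈ ⨆ m : {m : ℕ // n < m}, 𝒜 m.1

/-! Cancellation. The discriminant is canonical up to central units, so an isomorphism `φ :
A[t₁,…,t_d] ≅ B[t₁,…,t_d]` carries the discriminant of `A` to a constant
(`map_centerDiscr_eq_single`). In a polynomial ring over a domain, factors of a nonzero constant are
constant, so by induction on the stages `φ` maps all of the divisor subalgebra, hence `A`, into `B`.
For surjectivity, transcendence degree makes the center of `B` algebraic over that of `A`, and only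
constants are algebraic in a polynomial ring; so the centers correspond, and the images of a basis
of `A` span `B`.

Unipotent automorphisms. The discriminant is homogeneous and fixed by a unipotent `g`. Encode `g` as
`G : A → A[T, T⁻¹]`, which sends `v` of degree `n` to `∑ₘ (g v)ₘ Tᵐ⁻ⁿ`. Here `T⁰` has coefficient
`v`, and `G` sends the discriminant to itself. Factors of a nonzero monomial are monomials, so by
the same induction `G` is the inclusion of `A`, that is, `g = 1`.

Both halves rest on `AddMonoidAlgebra.eq_single_of_mul_eq_single`, for exponents in `ℕ^d` and in
`ℤ`. -/

section Discriminant

/-! ### Discriminants over the center: transport and change of basis. -/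

variable {ι : Type*} [Fintype ι]

/-- `η` need not be bijective, so that this covers both isomorphisms and the inclusion of constants
into a polynomial ring. -/
theorem Module.Basis.repr_map_of_center {A R : Type*} [Ring A] [Ring R] (η : A →+* R)
    (hη : ∀ z ∈ Subring.center A, η z ∈ Subring.center R)
    (b : Module.Basis ι (Subring.center A) A) (c : Module.Basis ι (Subring.center R) R)
    (hc : ∀ i, c i = η (b i)) (x : A) (i : ι) :
    (c.repr (η x) i : R) = η (b.repr x i) := by
  have h : η x = ∑ i, (⟨η (b.repr x i), hη _ (b.repr x i).2⟩ : Subring.center R) • c i := by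
    conv_lhs => rw [← b.sum_repr x]
    simp [map_sum, hc, Subring.smul_def]
  rw [h, c.repr_sum_self]

/-- Compatible bases over the centers have compatible discriminants. -/
theorem centerDiscr_map [DecidableEq ι] {A R : Type*} [Ring A] [Ring R] (η : A →+* R)
    (hη : ∀ z ∈ Subring.center A, η z ∈ Subring.center R)
    (b : Module.Basis ι (Subring.center A) A) (c : Module.Basis ι (Subring.center R) R)
    (hc : ∀ i, c i = η (b i)) : (centerDiscr c : R) = η (centerDiscr b) := by
  let ηZ : Subring.center A →+* Subring.center R :=
    (η.comp (Subring.center A).subtype).codRestrict _ fun z => hη z z.2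
  have htr (x : A) : LinearMap.trace (Subring.center R) R (LinearMap.mulLeft _ (η x)) =
      ηZ (LinearMap.trace (Subring.center A) A (LinearMap.mulLeft _ x)) := by
    rw [LinearMap.trace_eq_matrix_trace _ c, LinearMap.trace_eq_matrix_trace _ b, Matrix.trace,
      Matrix.trace, map_sum]
    refine Finset.sum_congr rfl fun i _ => Subtype.ext ?_
    simp only [Matrix.diag_apply, LinearMap.toMatrix_apply, LinearMap.mulLeft_apply, hc]
    rw [← map_mul, Module.Basis.repr_map_of_center η hη b c hc]
    rfl
  have h : centerDiscr c = ηZ (centerDiscr b) := by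
    unfold centerDiscr
    rw [RingHom.map_det]
    congr 1
    ext i j : 2
    simp only [Matrix.of_apply, RingHom.mapMatrix_apply, Matrix.map_apply, hc, ← map_mul, htr]
  rw [h]
  rfl

/-- The form `(x, y) ↦ tr (x y)` of a ring over its center. -/
noncomputable def centerTraceForm (A : Type*) [Ring A] :
    LinearMap.BilinForm (Subring.center A) A :=
  (LinearMap.mul (Subring.center A) A).compr₂
    ((LinearMap.trace (Subring.center A) A).comp (LinearMap.mul (Subring.center A) A))

theorem centerDiscr_eq_det [DecidableEq ι] {A : Type*} [Ring A] (b : Module.Basis ι (Subring.center A) A) :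
    centerDiscr b = (LinearMap.BilinForm.toMatrix b (centerTraceForm A)).det := by
  unfold centerDiscr
  congr 1
  ext i j : 2
  simp only [Matrix.of_apply, LinearMap.BilinForm.toMatrix_apply]
  rfl

/-- A change of basis multiplies the discriminant by a unit of the center. -/
theorem exists_unit_centerDiscr_eq [DecidableEq ι] {A : Type*} [Ring A]
    (b c : Module.Basis ι (Subring.center A) A) :
    ∃ u : (Subring.center A)ˣ, centerDiscr c = u * centerDiscr b := by
  have hu : IsUnit (b.toMatrix c).det := by
    have := Module.Basis.invertibleToMatrix b c
    exact Matrix.isUnit_det_of_invertible _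
  obtain ⟨u, hu⟩ := hu
  -- The Gram matrix becomes `Pᵀ M P`, and `P` and `Pᵀ` each contribute the unit `det P`.
  refine ⟨u * u, ?_⟩
  rw [centerDiscr_eq_det, centerDiscr_eq_det,
    ← LinearMap.BilinForm.toMatrix_mul_basis_toMatrix b c, Matrix.det_mul, Matrix.det_mul,
    Matrix.det_transpose, ← hu]
  push_cast
  ring

theorem RingEquiv.map_mem_center {A R : Type*} [Ring A] [Ring R] (e : A ≃+* R) {z : A}
    (hz : z ∈ Subring.center A) : e z ∈ Subring.center R := by
  rw [Subring.mem_center_iff] at hz ⊢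
  intro y
  obtain ⟨x, rfl⟩ := e.surjective y
  rw [← map_mul, ← map_mul, hz]

/-- A ring isomorphism carries a basis over the center to a basis over the center. -/
theorem exists_centerBasis_map {A R : Type*} [Ring A] [Ring R] (e : A ≃+* R)
    (b : Module.Basis ι (Subring.center A) A) :
    ∃ c : Module.Basis ι (Subring.center R) R, ∀ i, c i = e (b i) := by
  have hli : LinearIndependent (Subring.center R) fun i => e (b i) := by
    rw [Fintype.linearIndependent_iff]
    intro g hg i
    have h : ∑ i, (⟨e.symm (g i), e.symm.map_mem_center (g i).2⟩ : Subring.center A) • b i = 0 := by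
      apply e.injective
      simpa [map_sum, Subring.smul_def] using hg
    have := congrArg Subtype.val (Fintype.linearIndependent_iff.1 b.linearIndependent _ h i)
    simpa using this
  have hsp : ⊤ ≤ Submodule.span (Subring.center R) (Set.range fun i => e (b i)) := by
    intro y _
    have h : y = ∑ i, (⟨e (b.repr (e.symm y) i), e.map_mem_center (b.repr (e.symm y) i).2⟩ :
        Subring.center R) • e (b i) := by
      conv_lhs => rw [← e.apply_symm_apply y, ← b.sum_repr (e.symm y)]
      simp [map_sum, Subring.smul_def]
    rw [h]
    exact Submodule.sum_mem _ fun i _ =>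
      Submodule.smul_mem _ _ (Submodule.subset_span ⟨i, rfl⟩)
  exact ⟨Module.Basis.mk hli hsp, fun i => by simp⟩

/-- An automorphism multiplies the discriminant by a unit of the center. -/
theorem exists_unit_ringEquiv_centerDiscr [DecidableEq ι] {A : Type*} [Ring A] (e : A ≃+* A)
    (b : Module.Basis ι (Subring.center A) A) :
    ∃ u : (Subring.center A)ˣ, e (centerDiscr b) = u * (centerDiscr b : A) := by
  obtain ⟨c, hc⟩ := exists_centerBasis_map e b
  obtain ⟨u, hu⟩ := exists_unit_centerDiscr_eq b c
  refine ⟨u, ?_⟩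
  have h := centerDiscr_map (e : A →+* A) (fun z hz => e.map_mem_center hz) b c hc
  rw [hu] at h
  exact h.symm

end Discriminant

/-! ### Monomial factors, centers and bases of polynomial rings. -/

section MonoidAlgebra

open AddMonoidAlgebra

/-- If a product of two elements of the monoid algebra of an ordered monoid is a nonzero monomial,
then so are its factors. -/
theorem AddMonoidAlgebra.eq_single_of_mul_eq_single {R M : Type*} [Semiring R] [NoZeroDivisors R]
    [Add M] [TwoUniqueSums M] {x y : AddMonoidAlgebra R M} {n : M} {c : R} (hc : c ≠ 0)
    (h : x * y = single n c) :
    ∃ m m' a a', m + m' = n ∧ x = single m a ∧ y = single m' a' := by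
  classical
  have : Nonempty M := ⟨n⟩
  -- A pair with a unique sum contributes an uncancelled coefficient, so its sum must be `n`. Two
  -- distinct such pairs would share the sum `n`, against uniqueness.
  have key {p : M × M} (hp : p ∈ x.coeff.support ×ˢ y.coeff.support)
      (hu : UniqueAdd x.coeff.support y.coeff.support p.1 p.2) : p.1 + p.2 = n := by
    by_contra hne
    have h1 := AddMonoidAlgebra.coeff_mul_add_of_uniqueAdd hu
    rw [Finset.mem_product, Finsupp.mem_support_iff, Finsupp.mem_support_iff] at hp
    rw [h, coeff_single, Finsupp.single_eq_of_ne hne] at h1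
    exact mul_ne_zero hp.1 hp.2 h1.symm
  have hx : x.coeff.support.Nonempty := by
    rw [Finset.nonempty_iff_ne_empty, Ne, Finsupp.support_eq_empty, AddMonoidAlgebra.coeff_eq_zero]
    rintro rfl
    rw [zero_mul, eq_comm, AddMonoidAlgebra.single_eq_zero] at h
    exact hc h
  have hy : y.coeff.support.Nonempty := by
    rw [Finset.nonempty_iff_ne_empty, Ne, Finsupp.support_eq_empty, AddMonoidAlgebra.coeff_eq_zero]
    rintro rfl
    rw [mul_zero, eq_comm, AddMonoidAlgebra.single_eq_zero] at h
    exact hc h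
  have hcard : ¬ 1 < x.coeff.support.card * y.coeff.support.card := by
    intro hlt
    obtain ⟨p, hp, q, hq, hne, hup, huq⟩ := TwoUniqueSums.uniqueAdd_of_one_lt_card hlt
    rw [Finset.mem_product] at hq
    have := hup hq.1 hq.2 ((key (Finset.mem_product.2 hq) huq).trans (key hp hup).symm)
    exact hne (Prod.ext this.1.symm this.2.symm)
  have hxc := hx.card_pos
  have hyc := hy.card_pos
  obtain ⟨m, a, hxa⟩ := Finsupp.card_support_le_one'.1
    (show x.coeff.support.card ≤ 1 by nlinarith)
  obtain ⟨m', a', hya⟩ := Finsupp.card_support_le_one'.1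
    (show y.coeff.support.card ≤ 1 by nlinarith)
  have hx' : x = single m a := AddMonoidAlgebra.ext hxa
  have hy' : y = single m' a' := AddMonoidAlgebra.ext hya
  refine ⟨m, m', a, a', ?_, hx', hy'⟩
  by_contra hne
  rw [hx', hy', single_mul_single] at h
  have := congrArg (fun z => coeff z n) h
  simp [Finsupp.single_eq_of_ne (Ne.symm hne)] at this
  exact hc this.symm

variable {A : Type*} [Ring A] {d : ℕ}

theorem CentralPolynomial.coeff_mul_zero (x y : CentralPolynomial A d) :
    (x * y).coeff 0 = x.coeff 0 * y.coeff 0 := by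
  rw [AddMonoidAlgebra.coeff_mul_antidiag x y 0 {0} fun {p} => ?_]
  · simp
  · simp [Prod.ext_iff]

/-- Both factors are monomials, and exponents in `ℕ^d` that add to zero vanish. -/
theorem CentralPolynomial.eq_single_zero_of_mul [IsDomain A] {x y : CentralPolynomial A d} {c : A}
    (hc : c ≠ 0) (h : x * y = single 0 c) :
    x = single 0 (x.coeff 0) ∧ y = single 0 (y.coeff 0) := by
  obtain ⟨m, m', a, a', hm, rfl, rfl⟩ := AddMonoidAlgebra.eq_single_of_mul_eq_single hc h
  obtain ⟨rfl, rfl⟩ := add_eq_zero.1 hm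
  simp

theorem CentralPolynomial.coeff_mem_center {z : CentralPolynomial A d}
    (hz : z ∈ Subring.center (CentralPolynomial A d)) (m : Fin d →₀ ℕ) :
    z.coeff m ∈ Subring.center A := by
  rw [Subring.mem_center_iff] at hz ⊢
  intro a
  have h := congrArg (fun x => AddMonoidAlgebra.coeff x m) (hz (single 0 a))
  rwa [coeff_single_zero_mul, coeff_mul_single_zero] at h

theorem CentralPolynomial.mem_center_iff {z : CentralPolynomial A d} :
    z ∈ Subring.center (CentralPolynomial A d) ↔ ∀ m, z.coeff m ∈ Subring.center A := by
  refine ⟨fun hz m => coeff_mem_center hz m, fun hz => ?_⟩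
  rw [← AddMonoidAlgebra.sum_coeff_single z]
  refine Subring.sum_mem _ fun m _ => Subring.mem_center_iff.2 fun x => ?_
  exact (single_commute (fun _ => AddCommute.all _ _)
    (fun r => (Subring.mem_center_iff.1 (hz m) r).symm) x).symm

theorem CentralPolynomial.single_mem_center {a : A} (ha : a ∈ Subring.center A)
    (m : Fin d →₀ ℕ) : single m a ∈ Subring.center (CentralPolynomial A d) :=
  Subring.mem_center_iff.2 fun x => (single_commute (fun _ => AddCommute.all _ _)
    (fun r => (Subring.mem_center_iff.1 ha r).symm) x).symm

/-- Stated for spanning families because it is also applied before linear independence is known. -/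
theorem CentralPolynomial.span_single_zero {ι : Type*} {v : ι → A}
    (hv : ⊤ ≤ Submodule.span (Subring.center A) (Set.range v)) :
    ⊤ ≤ Submodule.span (Subring.center (CentralPolynomial A d))
      (Set.range fun i => (single 0 (v i) : CentralPolynomial A d)) := by
  intro x _
  have h0 (a : A) : (single 0 a : CentralPolynomial A d) ∈
      Submodule.span (Subring.center (CentralPolynomial A d))
        (Set.range fun i => (single 0 (v i) : CentralPolynomial A d)) := by
    induction hv (Submodule.mem_top (x := a)) using Submodule.span_induction with
    | mem x hx =>
      obtain ⟨i, rfl⟩ := hx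
      exact Submodule.subset_span ⟨i, rfl⟩
    | zero => simp
    | add x y _ _ hx hy => rw [single_add]; exact add_mem hx hy
    | smul z x _ hx =>
      have := Submodule.smul_mem _ (⟨single 0 (z : A), single_mem_center z.2 0⟩ :
        Subring.center (CentralPolynomial A d)) hx
      simpa [Subring.smul_def] using this
  rw [← AddMonoidAlgebra.sum_coeff_single x]
  refine Submodule.sum_mem _ fun m _ => ?_
  have := Submodule.smul_mem _ (⟨single m (1 : A), single_mem_center (Subring.one_mem _) m⟩ :
    Subring.center (CentralPolynomial A d)) (h0 (x.coeff m))
  simpa [Subring.smul_def] using this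

/-- A basis of `A` over its center is a basis of `A[t₁, …, t_d]` over its center. -/
theorem CentralPolynomial.exists_centerBasis {ι : Type*} [Fintype ι]
    (b : Module.Basis ι (Subring.center A) A) :
    ∃ c : Module.Basis ι (Subring.center (CentralPolynomial A d)) (CentralPolynomial A d),
      ∀ i, c i = single 0 (b i) := by
  have hli : LinearIndependent (Subring.center (CentralPolynomial A d))
      fun i => (single 0 (b i) : CentralPolynomial A d) := by
    rw [Fintype.linearIndependent_iff]
    intro g hg i
    refine Subtype.ext (AddMonoidAlgebra.ext (Finsupp.ext fun m => ?_))
    have h : ∑ i, (⟨(g i : CentralPolynomial A d).coeff m, coeff_mem_center (g i).2 m⟩ :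
        Subring.center A) • b i = 0 := by
      have := congrArg (fun x => AddMonoidAlgebra.coeff x m) hg
      simpa [Subring.smul_def, AddMonoidAlgebra.coeff_sum, coeff_mul_single_zero] using this
    exact congrArg Subtype.val (Fintype.linearIndependent_iff.1 b.linearIndependent _ h i)
  exact ⟨Module.Basis.mk hli (span_single_zero b.span_eq.ge), fun i => by simp⟩

end MonoidAlgebra

/-! ### Algebraic elements of polynomial rings and cancellation for the centers. -/

section MvPolynomial

/-- A nonzero algebraic element divides a nonzero constant, and divisors of such constants are
constant. -/
theorem MvPolynomial.exists_eq_C_of_isAlgebraic {R : Type*} [CommRing R] [IsDomain R] {d : ℕ}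
    {p : MvPolynomial (Fin d) R} (hp : IsAlgebraic R p) : ∃ r, p = MvPolynomial.C r := by
  rcases eq_or_ne p 0 with rfl | h0
  · exact ⟨0, by simp⟩
  obtain ⟨r, hr, y, hy⟩ := hp.exists_nonzero_dvd (mem_nonZeroDivisors_of_ne_zero h0)
  exact ⟨_, (CentralPolynomial.eq_single_zero_of_mul hr hy.symm).1⟩

/-- A ring homomorphism of domains whose extension to polynomial rings in `d` variables is
an isomorphism, for some choice of the images of the variables, is surjective. -/
theorem MvPolynomial.surjective_of_ringEquiv {R : Type*} {R' : Type*} [CommRing R] [CommRing R']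
    [IsDomain R] [IsDomain R'] {d : ℕ}
    (θ : MvPolynomial (Fin d) R ≃+* MvPolynomial (Fin d) R') (ψ : R →+* R')
    (h : ∀ r, θ (MvPolynomial.C r) = MvPolynomial.C (ψ r)) : Function.Surjective ψ := by
  algebraize [ψ]
  let e : MvPolynomial (Fin d) R ≃ₐ[R] MvPolynomial (Fin d) R' :=
    AlgEquiv.ofRingEquiv (f := θ) fun r => h r
  have hinj : Function.Injective ψ := fun a b hab =>
    MvPolynomial.C_injective _ _ (θ.injective (by rw [h, h, hab]))
  have : FaithfulSMul R R' := (faithfulSMul_iff_algebraMap_injective R R').2 hinj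
  have halg : Algebra.IsAlgebraic R R' := by
    rw [← trdeg_eq_zero_iff]
    have h1 := lift_trdeg_add_eq R R' (MvPolynomial (Fin d) R')
    have h2 := e.lift_trdeg_eq
    rw [MvPolynomial.trdeg_of_isDomain] at h1 h2
    simp only [Cardinal.mk_fin, Cardinal.lift_natCast] at h1 h2
    rw [eq_comm, Cardinal.lift_eq_nat_iff] at h2
    rw [h2, Cardinal.lift_id, Cardinal.lift_natCast] at h1
    -- Both polynomial rings have transcendence degree `d` over `R`, and the finite cardinal `d`
    -- cancels.
    have h3 : Algebra.trdeg R R' + (d : Cardinal) = 0 + (d : Cardinal) := by rw [zero_add, h1]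
    exact (Cardinal.add_nat_inj d).1 h3
  intro w
  have hw : IsAlgebraic R (MvPolynomial.C w : MvPolynomial (Fin d) R') :=
    (halg.isAlgebraic w).algebraMap
  obtain ⟨r, hr⟩ := MvPolynomial.exists_eq_C_of_isAlgebraic
    ((isAlgebraic_algHom_iff e.symm.toAlgHom e.symm.injective).2 hw)
  refine ⟨r, MvPolynomial.C_injective (Fin d) _ ?_⟩
  rw [← h, ← hr]
  exact θ.apply_symm_apply _

end MvPolynomial

/-! ### Isomorphisms of polynomial rings. -/

section Cancellation

open AddMonoidAlgebra

/-- The polynomial ring over the center is the center of the polynomial ring. -/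
noncomputable def CentralPolynomial.centerEquiv (A : Type*) [Ring A] (d : ℕ) :
    MvPolynomial (Fin d) (Subring.center A) ≃+* Subring.center (CentralPolynomial A d) :=
  RingEquiv.ofBijective
    ((mapRingHom (Fin d →₀ ℕ) (Subring.center A).subtype).codRestrict
      (Subring.center (CentralPolynomial A d)) fun p =>
        mem_center_iff.2 fun m => by rw [coeff_mapRingHom]; exact (p.coeff m).2) <| by
    constructor
    · intro p q hpq
      refine AddMonoidAlgebra.ext (Finsupp.ext fun m => Subtype.ext ?_)
      have := congrArg (fun x => AddMonoidAlgebra.coeff (Subtype.val x) m) hpq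
      simpa using this
    · intro z
      refine ⟨ofCoeff (Finsupp.onFinset z.1.coeff.support
        (fun m => ⟨z.1.coeff m, coeff_mem_center z.2 m⟩) fun m hm => ?_), Subtype.ext ?_⟩
      · rw [Finsupp.mem_support_iff]
        exact fun h => hm (Subtype.ext h)
      · refine AddMonoidAlgebra.ext (Finsupp.ext fun m => ?_)
        simp

theorem CentralPolynomial.coe_centerEquiv_C {A : Type*} [Ring A] {d : ℕ} (z : Subring.center A) :
    (centerEquiv A d (MvPolynomial.C z) : CentralPolynomial A d) = single 0 (z : A) :=
  mapRingHom_single _ _ _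

variable {A B : Type*} [Ring A] [Ring B] {d : ℕ}

/-- `φ` restricts to the centers, which are polynomial rings, so `ψ` is onto between the centers of
`A` and `B`. The elements `φ (b i) = ψ (b i)` form a basis of the polynomial ring over its center;
constant terms of expansions then write each `y` in `B` through the `ψ (b i)`. -/
theorem CentralPolynomial.surjective_of_map_single
    [IsDomain A] [IsDomain B] (φ : CentralPolynomial A d ≃+* CentralPolynomial B d)
    (ψ : A →+* B) (h : ∀ a, φ (single 0 a) = single 0 (ψ a)) {ι : Type*} [Fintype ι]
    (b : Module.Basis ι (Subring.center A) A) : Function.Surjective ψ := by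
  have hψ (z : Subring.center A) : ψ z ∈ Subring.center B := by
    have := φ.map_mem_center (single_mem_center z.2 0)
    rw [h] at this
    simpa using coeff_mem_center this 0
  let ψZ : Subring.center A →+* Subring.center B :=
    (ψ.comp (Subring.center A).subtype).codRestrict _ hψ
  let θ := ((centerEquiv A d).trans (Subring.centerCongr φ)).trans (centerEquiv B d).symm
  have hZ : Function.Surjective ψZ := by
    refine MvPolynomial.surjective_of_ringEquiv θ ψZ fun r => ?_
    refine (centerEquiv B d).symm_apply_eq.2 (Subtype.ext ?_)
    rw [coe_centerEquiv_C]
    change φ (centerEquiv A d (MvPolynomial.C r)) = _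
    rw [coe_centerEquiv_C, h]
    rfl
  obtain ⟨b', hb'⟩ := CentralPolynomial.exists_centerBasis (d := d) b
  obtain ⟨c, hc⟩ := exists_centerBasis_map φ b'
  intro y
  choose z hz using fun i => hZ ⟨_, coeff_mem_center (c.repr (single 0 y) i).2 0⟩
  refine ⟨∑ i, z i * b i, ?_⟩
  have h1 := congrArg (fun x => AddMonoidAlgebra.coeff x 0) (c.sum_repr (single 0 y))
  simp only [coeff_sum, Finsupp.finsetSum_apply, Subring.smul_def, smul_eq_mul,
    coeff_mul_zero, hc, hb', h, coeff_single, Finsupp.single_eq_same] at h1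
  rw [map_sum, ← h1]
  refine Finset.sum_congr rfl fun i _ => ?_
  rw [map_mul]
  congr 1
  exact congrArg Subtype.val (hz i)

/-- An isomorphism of polynomial rings sends the discriminant to a constant polynomial. -/
theorem CentralPolynomial.map_centerDiscr_eq_single [IsDomain A]
    (φ : CentralPolynomial A d ≃+* CentralPolynomial B d) {ι : Type*} [Fintype ι]
    [DecidableEq ι] (b : Module.Basis ι (Subring.center A) A) :
    ∃ y, φ (single 0 (centerDiscr b : A)) = single 0 y := by
  have hT : IsDomain (CentralPolynomial B d) := φ.symm.injective.isDomain φ.symm.toRingHom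
  have hBinj : Function.Injective (singleZeroRingHom : B →+* CentralPolynomial B d) :=
    fun x y hxy => by simpa using congrArg (fun x => AddMonoidAlgebra.coeff x 0) hxy
  have hB : IsDomain B := hBinj.isDomain _
  obtain ⟨b', hb'⟩ := CentralPolynomial.exists_centerBasis (d := d) b
  obtain ⟨c, hc⟩ := exists_centerBasis_map φ b'
  -- Taking constant terms of expansions in `c` shows that the `β i` span `B` over its center.
  let β (i : ι) : B := (c i).coeff 0
  have hβ : ⊤ ≤ Submodule.span (Subring.center B) (Set.range β) := by
    intro y _
    have h1 := congrArg (fun x => AddMonoidAlgebra.coeff x 0) (c.sum_repr (single 0 y))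
    simp only [coeff_sum, Finsupp.finsetSum_apply, Subring.smul_def, smul_eq_mul,
      coeff_mul_zero, coeff_single, Finsupp.single_eq_same] at h1
    rw [← h1]
    exact Submodule.sum_mem _ fun i _ => Submodule.smul_mem _
      (⟨_, coeff_mem_center (c.repr (single 0 y) i).2 0⟩ : Subring.center B)
      (Submodule.subset_span ⟨i, rfl⟩)
  have hsp := span_single_zero (d := d) hβ
  -- A spanning family with as many members as the rank is a basis; this makes `B` free over its
  -- center.
  have hliT := linearIndependent_of_top_le_span_of_card_eq_finrank hsp
    (Module.finrank_eq_card_basis c).symm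
  have hli : LinearIndependent (Subring.center B) β := by
    rw [Fintype.linearIndependent_iff]
    intro g hg i
    have h : ∑ i, (⟨single 0 (g i : B), single_mem_center (g i).2 0⟩ :
        Subring.center (CentralPolynomial B d)) • (single 0 (β i) : CentralPolynomial B d) = 0 := by
      have h2 := congrArg (singleZeroRingHom : B →+* CentralPolynomial B d) hg
      simpa [map_sum, Subring.smul_def] using h2
    have := congrArg (fun x => AddMonoidAlgebra.coeff (Subtype.val x) 0)
      (Fintype.linearIndependent_iff.1 hliT _ h i)
    exact Subtype.ext (by simpa using this)
  let βB := Module.Basis.mk hli hβ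
  let βT := Module.Basis.mk hliT hsp
  have h1 : (centerDiscr b' : CentralPolynomial A d) = single 0 (centerDiscr b : A) :=
    centerDiscr_map singleZeroRingHom (fun z hz => single_mem_center hz 0) b b' hb'
  have h2 : (centerDiscr c : CentralPolynomial B d) = φ (centerDiscr b' : CentralPolynomial A d) :=
    centerDiscr_map (φ : CentralPolynomial A d →+* CentralPolynomial B d)
      (fun z hz => φ.map_mem_center hz) b' c hc
  have h3 : (centerDiscr βT : CentralPolynomial B d) = single 0 (centerDiscr βB : B) :=
    centerDiscr_map singleZeroRingHom (fun z hz => single_mem_center hz 0) βB βT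
      fun i => by simp [βB, βT]
  obtain ⟨u, hu⟩ := exists_unit_centerDiscr_eq βT c
  -- The unit relating the two discriminants divides `1`, so it is constant.
  have huv : u.val.val * u⁻¹.val.val = single 0 1 := congrArg Subtype.val u.mul_inv
  refine ⟨u.val.val.coeff 0 * (centerDiscr βB : B), ?_⟩
  rw [← h1, ← h2, hu, Subring.coe_mul, h3, (eq_single_zero_of_mul one_ne_zero huv).1]
  simp

/-- If the discriminant divisor subalgebra of `A` is `A`, then an isomorphism
`A[t₁, …, t_d] ≅ B[t₁, …, t_d]` maps `A` onto `B`. -/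
theorem CentralPolynomial.exists_algEquiv (k : Type*) [Field k] [Algebra k A] [Algebra k B]
    [IsDomain A] {ι : Type*} [Fintype ι] [DecidableEq ι] (b : Module.Basis ι (Subring.center A) A)
    (hD : discriminantDivisorSubalgebra k b = ⊤)
    (φ : CentralPolynomial A d ≃ₐ[k] CentralPolynomial B d) : Nonempty (A ≃ₐ[k] B) := by
  have hT : IsDomain (CentralPolynomial B d) :=
    φ.symm.injective.isDomain φ.symm.toRingEquiv.toRingHom
  have hBinj : Function.Injective (singleZeroRingHom : B →+* CentralPolynomial B d) :=
    fun x y hxy => by simpa using congrArg (fun x => AddMonoidAlgebra.coeff x 0) hxy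
  have hB : IsDomain B := hBinj.isDomain _
  -- The elements of `A` that `φ` sends to constants.
  let S : Subalgebra k A := (singleZeroAlgHom (R := k) (A := B) (M := Fin d →₀ ℕ)).range.comap
    ((φ : CentralPolynomial A d →ₐ[k] CentralPolynomial B d).comp singleZeroAlgHom)
  have hS (a : A) : a ∈ S ↔ ∃ y : B, single 0 y = φ (single 0 a) := Iff.rfl
  have hstage (n : ℕ) : divisorStage k {(centerDiscr b : A)} n ⊆ S := by
    induction n with
    | zero =>
      rintro _ rfl
      obtain ⟨y, hy⟩ := map_centerDiscr_eq_single φ.toRingEquiv b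
      exact (hS _).2 ⟨y, hy.symm⟩
    | succ n ih =>
      refine Algebra.adjoin_le ?_
      rintro g ⟨f, hf, hf0, a, a', rfl⟩
      obtain ⟨y, hy⟩ := (hS _).1 (ih hf)
      have hy0 : y ≠ 0 := by
        rintro rfl
        rw [single_zero, eq_comm, map_eq_zero_iff _ φ.injective, AddMonoidAlgebra.single_eq_zero]
          at hy
        exact hf0 hy
      have h : φ (single 0 a) * (φ (single 0 g) * φ (single 0 a')) = single 0 y := by
        rw [hy, ← map_mul, ← map_mul]
        simp [mul_assoc]
      have h1 := (eq_single_zero_of_mul hy0 h).2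
      have hne : (φ (single 0 g) * φ (single 0 a')).coeff 0 ≠ 0 := by
        intro h0
        rw [h1, h0, single_zero, mul_zero, eq_comm, AddMonoidAlgebra.single_eq_zero] at h
        exact hy0 h
      exact (hS _).2 ⟨_, (eq_single_zero_of_mul hne h1).1.symm⟩
  have htop (a : A) : ∃ y : B, single 0 y = φ (single 0 a) := by
    have ha : a ∈ discriminantDivisorSubalgebra k b := hD ▸ Algebra.mem_top
    obtain ⟨n, hn⟩ := Set.mem_iUnion.1 ha
    exact hstage n hn
  choose f hf using htop
  have hsinj : Function.Injective (single 0 : B → CentralPolynomial B d) := hBinj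
  let ψ : A →ₐ[k] B :=
    { toFun := f
      map_one' := hsinj (by rw [hf]; exact map_one φ)
      map_mul' := fun x y => hsinj (by
        rw [hf, ← zero_add (0 : Fin d →₀ ℕ), ← single_mul_single, map_mul,
          ← single_mul_single (m₁ := (0 : Fin d →₀ ℕ)), hf, hf])
      map_zero' := hsinj (by rw [hf, single_zero, map_zero, single_zero])
      map_add' := fun x y => hsinj (by rw [hf, single_add, map_add, single_add, hf, hf])
      commutes' := fun r => hsinj (by
        rw [hf]
        exact φ.commutes r) }
  refine ⟨AlgEquiv.ofBijective ψ ⟨?_, ?_⟩⟩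
  · intro x y hxy
    have h : φ (single 0 x) = φ (single 0 y) := by
      rw [← hf, ← hf]
      exact congrArg (single 0) hxy
    simpa using congrArg (fun x => AddMonoidAlgebra.coeff x 0) (φ.injective h)
  · exact surjective_of_map_single φ.toRingEquiv ψ.toRingHom (fun a => (hf a).symm) b

end Cancellation

/-! ### Graded algebras, homogeneity of the discriminant, and unipotent automorphisms. -/

section Graded

open AddMonoidAlgebra DirectSum

variable {k : Type*} [Field k] {A : Type*} [Ring A] [Algebra k A] (𝒜 : ℕ → Submodule k A)
  [GradedAlgebra 𝒜]

/-- The algebra homomorphism `v ↦ h v * tⁿ` for `v` homogeneous of degree `n`, where `t` is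
central. -/
noncomputable def GradedAlgebra.twist {R : Type*} [Ring R] [Algebra k R] (h : A →ₐ[k] R) (t : R)
    (ht : ∀ x, Commute t x) : A →ₐ[k] R :=
  (DirectSum.toAlgebra k (fun n => 𝒜 n)
    (fun n => (LinearMap.mulRight k (t ^ n)).comp (h.toLinearMap.comp (𝒜 n).subtype))
    (by simp [GradedMonoid.GOne.one])
    (fun {i j} v w => by
      simp only [LinearMap.comp_apply, Submodule.subtype_apply, AlgHom.toLinearMap_apply,
        LinearMap.mulRight_apply, GradedMonoid.GMul.mul, map_mul, pow_add]
      rw [mul_assoc, mul_assoc, ← mul_assoc (h (w : A)), ← mul_assoc (t ^ i),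
        ((ht (h (w : A))).pow_left i).eq])).comp
    (DirectSum.decomposeAlgEquiv 𝒜).toAlgHom

theorem GradedAlgebra.twist_apply_of_mem {R : Type*} [Ring R] [Algebra k R] (h : A →ₐ[k] R) (t : R)
    (ht : ∀ x, Commute t x) {n : ℕ} {v : A} (hv : v ∈ 𝒜 n) :
    twist 𝒜 h t ht v = h v * t ^ n := by
  simp only [twist, AlgHom.comp_apply]
  change DirectSum.toAlgebra k _ _ _ _ (decompose 𝒜 v) = _
  rw [decompose_of_mem 𝒜 hv, DirectSum.toAlgebra_apply]
  exact DirectSum.toSemiring_of _ _ _ _ _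

theorem GradedAlgebra.ext_decompose {x y : A}
    (h : ∀ n, (decompose 𝒜 x n : A) = decompose 𝒜 y n) : x = y := by
  apply (decompose 𝒜).injective
  ext n
  exact h n

theorem AddMonoidAlgebra.single_one_commute (e : ℤ) (x : AddMonoidAlgebra A ℤ) :
    Commute (single e (1 : A)) x :=
  single_commute (fun _ => AddCommute.all _ _) (fun _ => Commute.one_left _) x

/-- The coaction `v ↦ v Tⁿ`, for `v` homogeneous of degree `n`. -/
noncomputable def GradedAlgebra.coaction : A →ₐ[k] AddMonoidAlgebra A ℤ :=
  twist 𝒜 singleZeroAlgHom (single 1 1) (single_one_commute 1)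

theorem GradedAlgebra.coaction_of_mem {n : ℕ} {v : A} (hv : v ∈ 𝒜 n) :
    coaction 𝒜 v = single (n : ℤ) v := by
  rw [coaction, twist_apply_of_mem 𝒜 _ _ _ hv, single_pow]
  simp

theorem GradedAlgebra.coeff_coaction (x : A) (n : ℕ) :
    (coaction 𝒜 x).coeff (n : ℤ) = decompose 𝒜 x n := by
  induction x using DirectSum.Decomposition.inductionOn 𝒜 with
  | zero => simp
  | @homogeneous m v =>
    rw [coaction_of_mem 𝒜 v.2]
    rcases eq_or_ne m n with rfl | hne
    · rw [coeff_single, Finsupp.single_eq_same, decompose_of_mem_same 𝒜 v.2]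
    · rw [decompose_of_mem_ne 𝒜 v.2 hne, coeff_single, Finsupp.single_eq_of_ne]
      exact_mod_cast hne.symm
  | add x y hx hy => simp [hx, hy]

theorem GradedAlgebra.coeff_coaction_of_neg (x : A) {n : ℤ} (hn : n < 0) :
    (coaction 𝒜 x).coeff n = 0 := by
  induction x using DirectSum.Decomposition.inductionOn 𝒜 with
  | zero => simp
  | @homogeneous m v =>
    rw [coaction_of_mem 𝒜 v.2, coeff_single, Finsupp.single_eq_of_ne]
    omega
  | add x y hx hy => simp [hx, hy]

theorem GradedAlgebra.coaction_injective : Function.Injective (coaction 𝒜) := fun x y h =>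
  ext_decompose 𝒜 fun n => by rw [← coeff_coaction, ← coeff_coaction, h]

/-- Units of a connected graded domain are scalars. -/
theorem GradedAlgebra.exists_eq_algebraMap_of_mul_eq_one [IsDomain A]
    (hconn : IsConnectedGrading k 𝒜) {u v : A} (huv : u * v = 1) :
    ∃ r : k, u = algebraMap k A r := by
  -- Both images are monomials; their exponents are nonnegative and sum to zero, so `u` has degree
  -- zero.
  have h : coaction 𝒜 u * coaction 𝒜 v = single 0 1 := by
    rw [← map_mul, huv, map_one]
    rfl
  obtain ⟨m, m', a, a', hm, hu, hv⟩ :=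
    AddMonoidAlgebra.eq_single_of_mul_eq_single one_ne_zero h
  have nonneg {x : A} {m : ℤ} {a : A} (hx0 : x ≠ 0) (hx : coaction 𝒜 x = single m a) : 0 ≤ m := by
    by_contra hm
    have h1 := coeff_coaction_of_neg 𝒜 x (not_le.1 hm)
    rw [hx, coeff_single, Finsupp.single_eq_same] at h1
    rw [h1, single_zero, map_eq_zero_iff _ (coaction_injective 𝒜)] at hx
    exact hx0 hx
  have hm0 : m = 0 := by
    have h1 := nonneg (left_ne_zero_of_mul_eq_one huv) hu
    have h2 := nonneg (right_ne_zero_of_mul_eq_one huv) hv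
    omega
  subst hm0
  have hmem : u ∈ 𝒜 0 := by
    have : u = decompose 𝒜 u 0 := ext_decompose 𝒜 fun n => by
      rcases eq_or_ne n 0 with rfl | hn
      · simp
      · rw [decompose_of_mem_ne 𝒜 (decompose 𝒜 u 0).2 hn.symm, ← coeff_coaction, hu, coeff_single,
          Finsupp.single_eq_of_ne]
        exact_mod_cast hn
    rw [this]
    exact (decompose 𝒜 u 0).2
  rw [hconn] at hmem
  obtain ⟨r, hr⟩ := Algebra.mem_bot.1 ((Subalgebra.mem_toSubmodule _).1 hmem)
  exact ⟨r, hr.symm⟩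

/-- The endomorphism `v ↦ cⁿ v`, for `v` homogeneous of degree `n`. -/
noncomputable def GradedAlgebra.scaling (c : k) : A →ₐ[k] A :=
  twist 𝒜 (AlgHom.id k A) (algebraMap k A c) (Algebra.commute_algebraMap_left c)

theorem GradedAlgebra.scaling_of_mem (c : k) {n : ℕ} {v : A} (hv : v ∈ 𝒜 n) :
    scaling 𝒜 c v = c ^ n • v := by
  rw [scaling, twist_apply_of_mem 𝒜 _ _ _ hv, ← map_pow, ← Algebra.commutes, Algebra.smul_def]
  rfl

theorem GradedAlgebra.scaling_scaling {c c' : k} (h : c * c' = 1) (x : A) :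
    scaling 𝒜 c (scaling 𝒜 c' x) = x := by
  induction x using DirectSum.Decomposition.inductionOn 𝒜 with
  | zero => simp
  | homogeneous v =>
    rw [scaling_of_mem 𝒜 c' v.2, map_smul, scaling_of_mem 𝒜 c v.2, smul_smul, ← mul_pow,
      mul_comm c', h, one_pow, one_smul]
  | add x y hx hy => simp [hx, hy]

theorem GradedAlgebra.decompose_scaling (c : k) (x : A) (n : ℕ) :
    (decompose 𝒜 (scaling 𝒜 c x) n : A) = c ^ n • (decompose 𝒜 x n : A) := by
  induction x using DirectSum.Decomposition.inductionOn 𝒜 with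
  | zero => simp
  | @homogeneous m v =>
    rw [scaling_of_mem 𝒜 c v.2]
    rcases eq_or_ne m n with rfl | hne
    · rw [decompose_of_mem_same 𝒜 (Submodule.smul_mem _ _ v.2), decompose_of_mem_same 𝒜 v.2]
    · rw [decompose_of_mem_ne 𝒜 (Submodule.smul_mem _ _ v.2) hne, decompose_of_mem_ne 𝒜 v.2 hne,
        smul_zero]
  | add x y hx hy => simp [hx, hy]

theorem GradedAlgebra.exists_smul_centerDiscr [IsDomain A] (hconn : IsConnectedGrading k 𝒜)
    {ι : Type*} [Fintype ι] [DecidableEq ι] (b : Module.Basis ι (Subring.center A) A)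
    (g : A ≃ₐ[k] A) : ∃ r : k, g (centerDiscr b : A) = r • (centerDiscr b : A) := by
  obtain ⟨u, hu⟩ := exists_unit_ringEquiv_centerDiscr g.toRingEquiv b
  obtain ⟨r, hr⟩ := exists_eq_algebraMap_of_mul_eq_one 𝒜 hconn
    (show u.val.val * u⁻¹.val.val = 1 from congrArg Subtype.val u.mul_inv)
  exact ⟨r, by rw [Algebra.smul_def, ← hr]; exact hu⟩

/-- The discriminant of a connected graded domain over its center is homogeneous. -/
theorem GradedAlgebra.exists_centerDiscr_mem [CharZero k] [IsDomain A]
    (hconn : IsConnectedGrading k 𝒜) {ι : Type*} [Fintype ι] [DecidableEq ι]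
    (b : Module.Basis ι (Subring.center A) A) : ∃ n, (centerDiscr b : A) ∈ 𝒜 n := by
  set f : A := (centerDiscr b : A)
  -- Scaling by `2` multiplies the degree `n` part by `2 ^ n` and the discriminant by a scalar `r`.
  -- Powers of `2` are distinct in characteristic zero, so a single degree survives.
  have h2 : (2 : k) ≠ 0 := two_ne_zero
  obtain ⟨r, hr⟩ := exists_smul_centerDiscr 𝒜 hconn b
    (AlgEquiv.ofAlgHom (scaling 𝒜 2) (scaling 𝒜 2⁻¹)
      (AlgHom.ext (scaling_scaling 𝒜 (mul_inv_cancel₀ h2)))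
      (AlgHom.ext (scaling_scaling 𝒜 (inv_mul_cancel₀ h2))))
  have hr' : scaling 𝒜 2 f = r • f := hr
  have hdec (n : ℕ) (hn : (decompose 𝒜 f n : A) ≠ 0) : (2 : k) ^ n = r := by
    have h := decompose_scaling 𝒜 2 f n
    rw [hr', decompose_smul] at h
    exact (smul_left_injective k hn h).symm
  by_cases h0 : f = 0
  · exact ⟨0, h0 ▸ Submodule.zero_mem _⟩
  obtain ⟨n, hn⟩ : ∃ n, (decompose 𝒜 f n : A) ≠ 0 := by
    by_contra! hall
    exact h0 (ext_decompose 𝒜 fun n => by rw [hall n]; simp)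
  refine ⟨n, ?_⟩
  have : f = decompose 𝒜 f n := ext_decompose 𝒜 fun m => by
    rcases eq_or_ne m n with rfl | hmn
    · simp
    · rw [decompose_of_mem_ne 𝒜 (decompose 𝒜 f n).2 hmn.symm]
      by_contra hm
      have h := (hdec m hm).trans (hdec n hn).symm
      exact hmn (Nat.pow_right_injective le_rfl (by exact_mod_cast h))
  rw [this]
  exact (decompose 𝒜 f n).2

variable {𝒜} in
theorem IsUnipotentAut.decompose_apply {g : A ≃ₐ[k] A} (hg : IsUnipotentAut k 𝒜 g) {n : ℕ} {v : A}
    (hv : v ∈ 𝒜 n) : (decompose 𝒜 (g v) n : A) = v := by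
  have hle : (⨆ m : {m : ℕ // n < m}, 𝒜 m.1) ≤ LinearMap.ker (GradedAlgebra.proj 𝒜 n) :=
    iSup_le fun m x hx => decompose_of_mem_ne 𝒜 hx m.2.ne'
  have h : (decompose 𝒜 (g v - v) n : A) = 0 := hle (hg n v hv)
  rw [decompose_sub, DirectSum.sub_apply, AddSubgroupClass.coe_sub, decompose_of_mem_same 𝒜 hv,
    sub_eq_zero] at h
  exact h

/-- The homomorphism `A → A[T, T⁻¹]` sending `v` of degree `n` to `∑ₘ (g v)ₘ Tᵐ⁻ⁿ`. -/
noncomputable def GradedAlgebra.homogenization (g : A ≃ₐ[k] A) : A →ₐ[k] AddMonoidAlgebra A ℤ :=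
  twist 𝒜 ((coaction 𝒜).comp g.toAlgHom) (single (-1) 1) (single_one_commute (-1))

theorem GradedAlgebra.homogenization_of_mem (g : A ≃ₐ[k] A) {n : ℕ} {v : A} (hv : v ∈ 𝒜 n) :
    homogenization 𝒜 g v = coaction 𝒜 (g v) * single (-(n : ℤ)) 1 := by
  rw [homogenization, twist_apply_of_mem 𝒜 _ _ _ hv, single_pow]
  simp

theorem GradedAlgebra.coeff_zero_homogenization {g : A ≃ₐ[k] A} (hg : IsUnipotentAut k 𝒜 g)
    (x : A) : (homogenization 𝒜 g x).coeff 0 = x := by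
  induction x using DirectSum.Decomposition.inductionOn 𝒜 with
  | zero => simp
  | @homogeneous n v =>
    rw [homogenization_of_mem 𝒜 g v.2, coeff_mul_single_eq_coeff_mul (n : ℤ) (by intros; omega),
      mul_one, coeff_coaction, hg.decompose_apply v.2]
  | add x y hx hy => simp [hx, hy]

/-- A unipotent automorphism of a connected graded domain which is equal to its discriminant divisor
subalgebra is trivial. -/
theorem IsUnipotentAut.eq_one [CharZero k] [IsDomain A] (hconn : IsConnectedGrading k 𝒜)
    {ι : Type*} [Fintype ι] [DecidableEq ι] (b : Module.Basis ι (Subring.center A) A)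
    (hD : discriminantDivisorSubalgebra k b = ⊤) {g : A ≃ₐ[k] A} (hg : IsUnipotentAut k 𝒜 g) :
    g = 1 := by
  let G := GradedAlgebra.homogenization 𝒜 g
  have hG0 (x : A) : (G x).coeff 0 = x := GradedAlgebra.coeff_zero_homogenization 𝒜 hg x
  have hmem (x : A) : x ∈ AlgHom.equalizer G singleZeroAlgHom ↔ G x = single 0 x := Iff.rfl
  have hGinj : ∀ x, G x = 0 → x = 0 := fun x hx => by rw [← hG0 x, hx]; rfl
  have hstage (n : ℕ) : divisorStage k {(centerDiscr b : A)} n ⊆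
      AlgHom.equalizer G singleZeroAlgHom := by
    induction n with
    | zero =>
      rintro _ rfl
      obtain ⟨n, hn⟩ := GradedAlgebra.exists_centerDiscr_mem 𝒜 hconn b
      obtain ⟨r, hr⟩ := GradedAlgebra.exists_smul_centerDiscr 𝒜 hconn b g
      -- `g` scales the discriminant by `r` and preserves its leading component, which is all of it;
      -- hence it is fixed.
      have h := hg.decompose_apply hn
      have hfix : g (centerDiscr b : A) = centerDiscr b := by
        rw [hr] at h
        rwa [decompose_of_mem_same 𝒜 (Submodule.smul_mem _ _ hn), ← hr] at h
      refine (hmem _).2 ?_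
      rw [GradedAlgebra.homogenization_of_mem 𝒜 g hn, hfix, GradedAlgebra.coaction_of_mem 𝒜 hn]
      simp
    | succ n ih =>
      refine Algebra.adjoin_le ?_
      rintro x ⟨f, hf, hf0, a, a', rfl⟩
      have h := (hmem _).1 (ih hf)
      rw [map_mul, map_mul] at h
      obtain ⟨m, m', c, c', -, h1, -⟩ := AddMonoidAlgebra.eq_single_of_mul_eq_single hf0 h
      have hc : c ≠ 0 := by
        rintro rfl
        rw [single_zero, ← map_mul] at h1
        exact hf0 (by rw [hGinj _ h1, zero_mul])
      obtain ⟨-, m, -, c, -, -, h2⟩ := AddMonoidAlgebra.eq_single_of_mul_eq_single hc h1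
      refine (hmem _).2 ?_
      have hx := hG0 x
      have hx0 : x ≠ 0 := by
        rintro rfl
        simp at hf0
      -- The coefficient of `T⁰` in the monomial `G x` is `x ≠ 0`, which forces the exponent.
      have hm : m = 0 := by
        by_contra hm
        rw [h2, coeff_single, Finsupp.single_eq_of_ne (Ne.symm hm)] at hx
        exact hx0 hx.symm
      subst hm
      rw [h2] at hx ⊢
      rw [coeff_single, Finsupp.single_eq_same] at hx
      rw [hx]
  have hG (x : A) : G x = single 0 x := by
    have hx : x ∈ discriminantDivisorSubalgebra k b := hD ▸ Algebra.mem_top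
    obtain ⟨n, hn⟩ := Set.mem_iUnion.1 hx
    exact hstage n hn
  ext x
  induction x using DirectSum.Decomposition.inductionOn 𝒜 with
  | zero => simp
  | @homogeneous n v =>
    apply GradedAlgebra.coaction_injective 𝒜
    have h := hG v
    simp only [G] at h
    rw [GradedAlgebra.homogenization_of_mem 𝒜 g v.2] at h
    -- Multiplying by `Tⁿ` turns `G v = v` into equality of the coactions of `g v` and `v`.
    replace h := congrArg (· * single (n : ℤ) (1 : A)) h
    simp only [mul_assoc, single_mul_single, mul_one, neg_add_cancel, zero_add] at h
    rw [AlgEquiv.one_apply, GradedAlgebra.coaction_of_mem 𝒜 v.2, ← h]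
    exact (mul_one _).symm
  | add x y hx hy => simp [hx, hy]

end Graded

/-! ### The one-variable case and the conclusion. -/

/-- One-variable polynomials as central polynomials in one variable. -/
noncomputable def Polynomial.centralPolynomialEquiv (k : Type*) [Field k] (A : Type*) [Ring A]
    [Algebra k A] : Polynomial A ≃ₐ[k] CentralPolynomial A 1 :=
  (AlgEquiv.ofRingEquiv (f := Polynomial.toFinsuppIso A) fun _ => rfl).trans
    (AddMonoidAlgebra.domCongr k A (Finsupp.uniqueAddEquiv (0 : Fin 1)).symm)

theorem theorem0p5 {k : Type u} [Field k] [CharZero k]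
    {A : Type v} [Ring A] [IsDomain A] [Algebra k A]
    (𝒜 : ℕ → Submodule k A) [GradedAlgebra 𝒜] (hconn : IsConnectedGrading k 𝒜)
    (hGK : gkDim k A < ⊤)
    {ι : Type*} [Fintype ι] [DecidableEq ι] (b : Module.Basis ι (Subring.center A) A)
    (hD : discriminantDivisorSubalgebra k b = ⊤) :
    IsCancellative.{u, v, w} k A ∧
      IsStronglyCancellative.{u, v, w} k A ∧
      ∀ g : A ≃ₐ[k] A, IsUnipotentAut k 𝒜 g → g = 1 := by
  refine ⟨fun B _ _ ⟨φ⟩ => ?_, fun d _ B _ _ ⟨φ⟩ => ?_, fun g hg => ?_⟩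
  · exact CentralPolynomial.exists_algEquiv k b hD
      (((Polynomial.centralPolynomialEquiv k A).symm.trans φ).trans
        (Polynomial.centralPolynomialEquiv k B))
  · exact CentralPolynomial.exists_algEquiv k b hD φ
  · exact IsUnipotentAut.eq_one 𝒜 hconn b hD hg
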